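/- Rank-one systems. Let $r_n\ge 2$ $(n\ge 0)$ be integers and let $s_n=(s_n(0),\dots,s_n(r_n-2))$ be tuples of nonnegative integers. The rank-one system $(X,\mu,T)$ with cutting and spacer parameters $(r_n),(s_n)$ is obtained by cutting and stacking: the column $C_0$ is the interval $[0,1)$; given the column $C_n$, a stack of $h_n$ disjoint left-closed right-open intervals (levels) of equal length, cut every level into $r_n$ subintervals of equal length, numbered $0,\dots,r_n-1$ from left to right, put $s_n(i)$ new disjoint intervals of that length (spacers) on top of the $i$-th subcolumn for $0\le i\le r_n-2$ and none on top of the last one, and stack right above left to obtain $C_{n+1}$. Here $X$ is the union of all levels of all columns, $\mu$ is Lebesgue measure on $X$, and $T$ maps each level of each column, except the top one, by translation onto the level above it. The rank-one words of the system are $w_0=0$ and $w_{n+1}=w_n1^{s_n(0)}w_n1^{s_n(1)}\cdots 1^{s_n(r_n-2)}w_n$, and $|w_n|$ denotes the length of $w_n$. For a strictly increasing sequence $(n_\ell)$, the cutting and spacer parameters $(q_\ell),(t_\ell)$ of the subsequence $(w_{n_\ell})$ are those for which $w_{n_{\ell+1}}=w_{n_\ell}1^{t_\ell(0)}w_{n_\ell}1^{t_\ell(1)}\cdots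 1^{t_\ell(q_\ell-2)}w_{n_\ell}$. Two finite sequences $s,s'$ of integers of the same length are incompatible if there is no integer $c$ such that $s$ is a (contiguous) substring of $s'\,c\,s'$. Two systems $(X,\mu,T)$ and $(Y,\nu,S)$ are isomorphic if there is an almost everywhere invertible measure-preserving map $\phi:X\to Y$, with measure-preserving inverse, such that $\phi\circ T=S\circ\phi$ almost everywhere. Proposition 6.3. Let $(X,\mu,T)$ and $(Y,\nu,S)$ be two rank-one systems with cutting and spacer parameters $(r_n),(s_n)$ and $(r_n'),(s_n')$ and rank-one words $(v_n)$ and $(w_n)$, respectively. Suppose that: 1. for all $n$, $r_n=r_n'$ and $\sum_{i=0}^{r_n-2}s_n(i)=\sum_{i=0}^{r_n'-2}s_n'(i)$ (the parameters are commensurable; in particular $|v_n|=|w_n|$ for all $n$); 2. there is $\mathfrak S>0$ such that $|s_n(i)-s_n'(j)|<\mathfrak S$ for all $n$ and all $0\le i,j<r_n-1$; 3. $s_n(i)\ge|v_n|$ and $s_n'(i)\ge|w_n|$ for all $n$ and all $0\le i<r_n-1$; 4. there are subsequences of rank-one words $(v_{n_\ell})$ and $(w_{n_\ell})$ (with the same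 indices), with corresponding cutting and spacer parameters $(q_\ell),(t_\ell)$ and $(q_\ell),(t_\ell')$, a number $\mathfrak Q>0$ and an infinite set $\mathbb M\subset\mathbb N$ such that for all $\ell\in\mathbb M$ we have $q_\ell<\mathfrak Q$ and $t_\ell$ and $t_\ell'$ are incompatible. Then $(X,\mu,T)$ and $(Y,\nu,S)$ are not isomorphic. -/

import Mathlib

open MeasureTheory

namespace RankOne

/-- The word `u 1^{t(0)} u 1^{t(1)} ⋯ 1^{t(k-1)} u` over the alphabet `{0,1}`,
where `t = [t(0), …, t(k-1)]`. -/
def build (u : List (Fin 2)) : List ℕ → List (Fin 2)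
  | [] => u
  | a :: t => u ++ List.replicate a 1 ++ build u t

/-- Two finite sequences of integers of the same length are incompatible if there is no integer `c`
such that `s` is a (contiguous) substring of `s' c s'`. -/
def Incompatible (s s' : List ℤ) : Prop :=
  ¬ ∃ c : ℤ, s <:+: s' ++ c :: s'

/-- Cutting and spacer parameters, with no spacers on the last subcolumn: at stage `n` the column is
cut into `cuts n ≥ 2` subcolumns, and `spacers n i` spacers are put above the `i`-th subcolumn,
`0 ≤ i ≤ cuts n - 2`. -/
structure Params where
  cuts : ℕ → ℕ
  two_le_cuts : ∀ n, 2 ≤ cuts n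
  spacers : ∀ n, Fin (cuts n - 1) → ℕ

namespace Params

variable (P : Params)

/-- The rank-one words: `w_0 = 0` and
`w_{n+1} = w_n 1^{s_n(0)} w_n 1^{s_n(1)} ⋯ 1^{s_n(r_n-2)} w_n`. -/
def word : ℕ → List (Fin 2)
  | 0 => [0]
  | n + 1 => build (word n) (List.ofFn (P.spacers n))

/-- The number of levels of the `n`-th column. -/
def height : ℕ → ℕ
  | 0 => 1
  | n + 1 => P.cuts n * height n + ∑ i, P.spacers n i

/-- The length of the levels of the `n`-th column. -/
noncomputable def width : ℕ → ℝ
  | 0 => 1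
  | n + 1 => width n / P.cuts n

/-- The index, in column `n + 1`, of the bottom level of the `i`-th subcolumn of column `n`: below
it lie `i` copies of column `n` and the spacers above the subcolumns `0, …, i - 1`. -/
def offset (n i : ℕ) : ℕ :=
  i * P.height n + ∑ k : Fin (P.cuts n - 1), if (k : ℕ) < i then P.spacers n k else 0

theorem length_build (u : List (Fin 2)) (t : List ℕ) :
    (build u t).length = (t.length + 1) * u.length + t.sum := by
  induction t with
  | nil => simp [build]
  | cons a t ih => simp [build, ih]; ring

theorem length_word (n : ℕ) : (P.word n).length = P.height n := by
  induction n with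
  | zero => rfl
  | succ n ih =>
    have h := P.two_le_cuts n
    rw [word, length_build, height, ih, List.length_ofFn, List.sum_ofFn,
      Nat.sub_add_cancel (by omega)]

theorem width_pos (n : ℕ) : 0 < P.width n := by
  induction n with
  | zero => simp [width]
  | succ n ih =>
    have h : (0 : ℝ) < P.cuts n := by exact_mod_cast (by have := P.two_le_cuts n; omega)
    exact div_pos ih h

theorem offset_add_height_le (n : ℕ) {i : ℕ} (hi : i < P.cuts n) :
    P.offset n i + P.height n ≤ P.height (n + 1) := by
  have h1 : (i + 1) * P.height n ≤ P.cuts n * P.height n := Nat.mul_le_mul_right _ hi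
  have h2 : (∑ k : Fin (P.cuts n - 1), if (k : ℕ) < i then P.spacers n k else 0)
      ≤ ∑ k, P.spacers n k := Finset.sum_le_sum fun k _ => by split_ifs <;> simp
  rw [offset, height]
  linarith

end Params

/-- A cutting and stacking construction on the line with parameters `P`. The `n`-th column consists
of the disjoint intervals (levels) `[left n j, left n j + width n)`, `0 ≤ j < height n`.
Column `0` is the single interval `[0,1)`. Column `n + 1` is obtained by cutting every
level of column `n` into `cuts n` intervals of equal length, numbered from left to right, putting
the prescribed numbers of new intervals of that length (the spacers, which may be chosen anywhere
off the intervals used so far) on top of the subcolumns, and stacking right above left. -/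
structure Construction (P : Params) where
  left : ℕ → ℕ → ℝ
  left_zero : left 0 0 = 0
  left_succ : ∀ n i j, i < P.cuts n → j < P.height n →
    left (n + 1) (P.offset n i + j) = left n j + i * P.width (n + 1)
  disjoint : ∀ n i j, i < P.height n → j < P.height n → i ≠ j →
    Disjoint (Set.Ico (left n i) (left n i + P.width n))
      (Set.Ico (left n j) (left n j + P.width n))

namespace Construction

variable {P : Params} (C : Construction P)

/-- The `j`-th level of the `n`-th column. -/
def level (n j : ℕ) : Set ℝ := Set.Ico (C.left n j) (C.left n j + P.width n)

/-- The space of the system: the union of all the levels of all the columns. -/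
def space : Set ℝ := ⋃ (n : ℕ) (j : ℕ) (_ : j < P.height n), C.level n j

/-- The measure of the system: Lebesgue measure on the space. -/
noncomputable def measure : Measure ℝ := volume.restrict C.space

open Classical in
/-- The rank-one transformation: every level of a column, except the top one, is translated
onto the level above it (see `map_eq`: the translation does not depend on the column). Points of the
line that lie in no such level are left alone. -/
noncomputable def map (x : ℝ) : ℝ :=
  if h : ∃ p : ℕ × ℕ, p.2 + 1 < P.height p.1 ∧ x ∈ C.level p.1 p.2 then
    x + (C.left h.choose.1 (h.choose.2 + 1) - C.left h.choose.1 h.choose.2)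
  else x

theorem exists_succ {n j : ℕ} {x : ℝ} (hj : j + 1 < P.height n) (hx : x ∈ C.level n j) :
    ∃ k, k + 1 < P.height (n + 1) ∧ x ∈ C.level (n + 1) k ∧
      C.left (n + 1) (k + 1) - C.left (n + 1) k = C.left n (j + 1) - C.left n j := by
  have hw := P.width_pos (n + 1)
  have hc : (0 : ℝ) < P.cuts n := by exact_mod_cast (by have := P.two_le_cuts n; omega)
  have hwn : P.width n = P.cuts n * P.width (n + 1) := by
    rw [Params.width]; field_simp
  obtain ⟨h1, h2⟩ := hx
  have h0 : 0 ≤ (x - C.left n j) / P.width (n + 1) := div_nonneg (by linarith) hw.le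
  obtain ⟨i, hi⟩ : ∃ i, i = ⌊(x - C.left n j) / P.width (n + 1)⌋₊ := ⟨_, rfl⟩
  have hi1 : (i : ℝ) * P.width (n + 1) ≤ x - C.left n j := by
    rw [← le_div_iff₀ hw, hi]; exact Nat.floor_le h0
  have hi2 : x - C.left n j < ((i : ℝ) + 1) * P.width (n + 1) := by
    rw [← div_lt_iff₀ hw, hi]; exact Nat.lt_floor_add_one _
  have hic : i < P.cuts n := by
    have : (i : ℝ) * P.width (n + 1) < P.cuts n * P.width (n + 1) := by linarith
    exact_mod_cast lt_of_mul_lt_mul_right this hw.le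
  have hle := P.offset_add_height_le n hic
  refine ⟨P.offset n i + j, by omega, ?_, ?_⟩
  · rw [level, C.left_succ n i j hic (by omega)]
    constructor <;> linarith
  · rw [add_assoc, C.left_succ n i j hic (by omega), C.left_succ n i (j + 1) hic hj]
    ring

theorem exists_add {n j : ℕ} {x : ℝ} (hj : j + 1 < P.height n) (hx : x ∈ C.level n j) (d : ℕ) :
    ∃ k, k + 1 < P.height (n + d) ∧ x ∈ C.level (n + d) k ∧
      C.left (n + d) (k + 1) - C.left (n + d) k = C.left n (j + 1) - C.left n j := by
  induction d with
  | zero => exact ⟨j, hj, hx, rfl⟩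
  | succ d ih =>
    obtain ⟨k, hk, hxk, e⟩ := ih
    obtain ⟨l, hl, hxl, e'⟩ := C.exists_succ hk hxk
    exact ⟨l, hl, hxl, e'.trans e⟩

theorem translation_unique {n m j k : ℕ} {x : ℝ} (hj : j + 1 < P.height n)
    (hx : x ∈ C.level n j) (hk : k + 1 < P.height m) (hx' : x ∈ C.level m k) :
    C.left n (j + 1) - C.left n j = C.left m (k + 1) - C.left m k := by
  obtain ⟨a, ha, hxa, ea⟩ := C.exists_add hj hx m
  obtain ⟨b, hb, hxb, eb⟩ := C.exists_add hk hx' n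
  rw [add_comm m n] at hb hxb eb
  have : a = b := by
    by_contra hne
    exact Set.disjoint_left.mp (C.disjoint (n + m) a b (by omega) (by omega) hne) hxa hxb
  rw [← ea, ← eb, this]

/-- The transformation sends each non-top level to the level above it by translation. -/
theorem map_eq {n j : ℕ} {x : ℝ} (hj : j + 1 < P.height n) (hx : x ∈ C.level n j) :
    C.map x = x + (C.left n (j + 1) - C.left n j) := by
  have h : ∃ p : ℕ × ℕ, p.2 + 1 < P.height p.1 ∧ x ∈ C.level p.1 p.2 := ⟨(n, j), hj, hx⟩
  rw [map, dif_pos h, C.translation_unique h.choose_spec.1 h.choose_spec.2 hj hx]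

end Construction

/-- Isomorphism of measure-preserving systems: an almost everywhere invertible
measure-preserving map, with measure-preserving inverse, that almost everywhere intertwines the two
transformations. -/
def Isomorphic {X Y : Type*} [MeasurableSpace X] [MeasurableSpace Y]
    (μ : Measure X) (T : X → X) (ν : Measure Y) (S : Y → Y) : Prop :=
  ∃ (φ : X → Y) (ψ : Y → X), MeasurePreserving φ μ ν ∧ MeasurePreserving ψ ν μ ∧
    (∀ᵐ x ∂μ, ψ (φ x) = x) ∧ (∀ᵐ y ∂ν, φ (ψ y) = y) ∧ ∀ᵐ x ∂μ, φ (T x) = S (φ x)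

end RankOne

/-! Suppose `φ` is measure preserving and intertwines `X` with `Y`. The heart is
`eventually_spacer_eq`: for each `Q`, the two systems have the same spacers at every sufficiently
late stage with at most `Q` cuts.

Fix `N` with `S ≤ h_N`, and let `A` be the preimage of the base of the `N`-th column of `Y`. By
Lebesgue density, at late stages `A` misses less than `1/Q` of some level
(`eventually_exists_level`). With at most `Q` cuts the missing part is smaller than one subinterval,
so some point `x` of the first subcolumn and all its translates in the other subcolumns lie in `A`
(`exists_mem_subcolumns`). Thus the orbit of `φ x` visits that base at times separated by `h_n +
s_n(i)`.

By `return_step`, each such gap moves the orbit in `Y` from one copy of column `n` to the next, and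
`s_n(i)` is exactly the number of spacers between them: a smaller discrepancy than `h_N` cannot
separate two visits to the base, and beyond the last copy lies a stretch of spacers too long to
cross. As both systems have `r_n` copies, these are matched in order and the spacers agree.

Incompatible `t`, `t'` are distinct, so the spacers differ at a stage inside the block, where there
are at most `q < 𝔔` cuts (`exists_spacers_ne`); far along the subsequence this is a contradiction.
-/

namespace RankOne

/-! ### Words and their spacer sequences -/

/-- The sequence `t s(0) t s(1) ⋯ s(k-1) t`, where `s = [s(0), …, s(k-1)]`. -/
def interleave (t : List ℕ) : List ℕ → List ℕ
  | [] => t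
  | a :: s => t ++ a :: interleave t s

theorem build_append_cons (u : List (Fin 2)) (t : List ℕ) (a : ℕ) (s : List ℕ) :
    build u (t ++ a :: s) = build u t ++ List.replicate a 1 ++ build u s := by
  induction t with
  | nil => rfl
  | cons b t ih => simp [build, ih]

theorem build_build (u : List (Fin 2)) (t s : List ℕ) :
    build (build u t) s = build u (interleave t s) := by
  induction s with
  | nil => rfl
  | cons a s ih => rw [interleave, build_append_cons, build, ih]

theorem length_interleave (t s : List ℕ) :
    (interleave t s).length + 1 = (t.length + 1) * (s.length + 1) := by
  induction s with
  | nil => simp [interleave]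
  | cons a s ih =>
    simp only [interleave, List.length_append, List.length_cons, ih]
    ring

theorem exists_build_eq_cons (v : List (Fin 2)) (t : List ℕ) :
    ∃ v', build (0 :: v) t = 0 :: v' := by
  cases t with
  | nil => exact ⟨v, rfl⟩
  | cons a t => exact ⟨_, rfl⟩

theorem eq_of_replicate_append_eq {a b : ℕ} {x y : List (Fin 2)}
    (h : List.replicate a 1 ++ 0 :: x = List.replicate b 1 ++ 0 :: y) : a = b := by
  induction a generalizing b with
  | zero =>
    cases b with
    | zero => rfl
    | succ b => simp [List.replicate_succ] at h
  | succ a ih =>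
    cases b with
    | zero => simp [List.replicate_succ] at h
    | succ b =>
      simp only [List.replicate_succ, List.cons_append, List.cons.injEq, true_and] at h
      rw [ih h]

/-- Since the block starts with `0`, the run of ones after it ends exactly where the next block
begins, so the spacers can be read off one at a time. -/
theorem build_injective (v : List (Fin 2)) : Function.Injective (build (0 :: v)) := by
  intro t
  induction t with
  | nil =>
    intro t' h
    cases t' with
    | nil => rfl
    | cons b t' =>
      have := congrArg List.length h
      simp only [build, List.length_append, List.length_cons] at this
      have := congrArg List.length (exists_build_eq_cons v t').choose_spec
      rw [List.length_cons] at this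
      omega
  | cons a t ih =>
    intro t' h
    cases t' with
    | nil =>
      have := congrArg List.length h
      simp only [build, List.length_append, List.length_cons] at this
      have := congrArg List.length (exists_build_eq_cons v t).choose_spec
      rw [List.length_cons] at this
      omega
    | cons b t' =>
      simp only [build, List.append_assoc, List.append_cancel_left_eq] at h
      obtain ⟨x, hx⟩ := exists_build_eq_cons v t
      obtain ⟨y, hy⟩ := exists_build_eq_cons v t'
      have hab : a = b := by
        rw [hx, hy] at h
        exact eq_of_replicate_append_eq h
      subst hab
      rw [List.append_cancel_left_eq] at h
      rw [ih h]

namespace Params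

variable (P : Params)

theorem exists_word_eq_cons (n : ℕ) : ∃ v, P.word n = 0 :: v := by
  induction n with
  | zero => exact ⟨[], rfl⟩
  | succ n ih =>
    obtain ⟨v, hv⟩ := ih
    rw [word, hv]
    exact exists_build_eq_cons v _

/-- The spacer parameters leading from the `n`-th to the `(n + d)`-th rank-one word. -/
def spacersFrom (n : ℕ) : ℕ → List ℕ
  | 0 => []
  | d + 1 => interleave (spacersFrom n d) (List.ofFn (P.spacers (n + d)))

theorem word_add (n d : ℕ) : P.word (n + d) = build (P.word n) (P.spacersFrom n d) := by
  induction d with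
  | zero => rfl
  | succ d ih => rw [← add_assoc, word, ih, build_build, spacersFrom]

theorem eq_spacersFrom {n d : ℕ} {t : List ℕ} (h : P.word (n + d) = build (P.word n) t) :
    t = P.spacersFrom n d := by
  obtain ⟨v, hv⟩ := P.exists_word_eq_cons n
  rw [word_add, hv] at h
  exact (build_injective v h).symm

theorem spacersFrom_congr {P P' : Params} {n d : ℕ}
    (h : ∀ i < d, List.ofFn (P.spacers (n + i)) = List.ofFn (P'.spacers (n + i))) :
    P.spacersFrom n d = P'.spacersFrom n d := by
  induction d with
  | zero => rfl
  | succ d ih => rw [spacersFrom, spacersFrom, ih fun i hi => h i (by omega), h d (by omega)]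

/-- The length plus one is the product of the numbers of cuts of the stages involved, hence at least
each factor. -/
theorem cuts_le_length_spacersFrom (n : ℕ) {d i : ℕ} (hi : i < d) :
    P.cuts (n + i) ≤ (P.spacersFrom n d).length + 1 := by
  induction d with
  | zero => omega
  | succ d ih =>
    have h2 := P.two_le_cuts (n + d)
    rw [spacersFrom, length_interleave, List.length_ofFn, Nat.sub_add_cancel (by omega)]
    rcases Nat.lt_succ_iff_lt_or_eq.mp hi with hi | rfl
    · exact (ih hi).trans (Nat.le_mul_of_pos_right _ (by omega))
    · exact Nat.le_mul_of_pos_left _ (by omega)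

/-- Passes from a difference between composite spacer sequences to one at a single stage, while
keeping the bound on the number of cuts. -/
theorem exists_spacers_ne {P P' : Params} {n m : ℕ} (hnm : n ≤ m) {t t' : List ℕ}
    (ht : P.word m = build (P.word n) t) (ht' : P'.word m = build (P'.word n) t') (hne : t ≠ t') :
    ∃ i, n ≤ i ∧ P.cuts i ≤ t.length + 1 ∧
      List.ofFn (P.spacers i) ≠ List.ofFn (P'.spacers i) := by
  obtain ⟨d, rfl⟩ := Nat.exists_eq_add_of_le hnm
  by_contra! hcon
  have e := P.eq_spacersFrom ht
  have e' := P'.eq_spacersFrom ht'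
  refine hne (e.trans ((spacersFrom_congr fun i hi => hcon _ (by omega) ?_).trans e'.symm))
  rw [e]
  exact P.cuts_le_length_spacersFrom n hi

/-! ### Arithmetic of heights, offsets and widths -/

/-- The number of spacers above the `i`-th subcolumn, and `0` if there is no such subcolumn. -/
def spacer (n i : ℕ) : ℕ := if h : i < P.cuts n - 1 then P.spacers n ⟨i, h⟩ else 0

theorem spacer_eq {n i : ℕ} (h : i < P.cuts n - 1) : P.spacer n i = P.spacers n ⟨i, h⟩ :=
  dif_pos h

theorem offset_zero (n : ℕ) : P.offset n 0 = 0 := by simp [offset]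

theorem offset_succ (n i : ℕ) :
    P.offset n (i + 1) = P.offset n i + P.height n + P.spacer n i := by
  have h : (∑ k : Fin (P.cuts n - 1), if (k : ℕ) < i + 1 then P.spacers n k else 0)
      = (∑ k : Fin (P.cuts n - 1), if (k : ℕ) < i then P.spacers n k else 0) + P.spacer n i := by
    have h1 : P.spacer n i = ∑ k : Fin (P.cuts n - 1), if (k : ℕ) = i then P.spacers n k else 0 := by
      unfold spacer
      split_ifs with hi
      · rw [Finset.sum_eq_single ⟨i, hi⟩]
        · simp
        · intro b _ hb
          rw [if_neg fun e => hb (Fin.ext e)]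
        · simp
      · symm
        refine Finset.sum_eq_zero fun k _ => if_neg ?_
        have := k.2
        omega
    rw [h1, ← Finset.sum_add_distrib]
    refine Finset.sum_congr rfl fun k _ => ?_
    split_ifs <;> omega
  rw [offset, offset, h]
  ring

theorem offset_last (n : ℕ) : P.offset n (P.cuts n - 1) + P.height n = P.height (n + 1) := by
  have h2 := P.two_le_cuts n
  have h : (∑ k : Fin (P.cuts n - 1), if (k : ℕ) < P.cuts n - 1 then P.spacers n k else 0)
      = ∑ k, P.spacers n k := Finset.sum_congr rfl fun k _ => if_pos k.2
  obtain ⟨c, hc⟩ := Nat.exists_eq_add_of_le' h2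
  rw [offset, h, height]
  have : P.cuts n - 1 + 1 = P.cuts n := by omega
  nlinarith

theorem height_pos (n : ℕ) : 0 < P.height n := by
  induction n with
  | zero => simp [height]
  | succ n ih =>
    have := P.offset_last n
    omega

theorem offset_strictMono (n : ℕ) : StrictMono (P.offset n) :=
  strictMono_nat_of_lt_succ fun i => by
    have := P.height_pos n
    rw [offset_succ]
    omega

theorem two_mul_height_add_spacer_le (n : ℕ) :
    2 * P.height n + P.spacer n 0 ≤ P.height (n + 1) := by
  have h := P.offset_add_height_le n (i := 1) (P.two_le_cuts n)
  rw [offset_succ, offset_zero] at h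
  omega

theorem height_mono : Monotone P.height :=
  monotone_nat_of_le_succ fun n => by have := P.two_mul_height_add_spacer_le n; omega

theorem lt_height (n : ℕ) : n < P.height n := by
  induction n with
  | zero => exact P.height_pos 0
  | succ n ih =>
    have := P.two_mul_height_add_spacer_le n
    omega

theorem width_eq (n : ℕ) : P.width n = P.cuts n * P.width (n + 1) := by
  have hc : (0 : ℝ) < P.cuts n := by exact_mod_cast (by have := P.two_le_cuts n; omega)
  rw [width]
  field_simp

theorem width_le (n : ℕ) : P.width n ≤ (1 / 2) ^ n := by
  induction n with
  | zero => simp [width]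
  | succ n ih =>
    have h2 : (2 : ℝ) ≤ P.cuts n := by exact_mod_cast P.two_le_cuts n
    have := P.width_eq n
    have := P.width_pos (n + 1)
    rw [pow_succ]
    nlinarith

theorem tendsto_width : Filter.Tendsto P.width Filter.atTop (nhds 0) :=
  squeeze_zero (fun n => (P.width_pos n).le) P.width_le
    (tendsto_pow_atTop_nhds_zero_of_lt_one (by norm_num) (by norm_num))

/-- Spacers lie strictly between consecutive copies of the column, so no copy meets them. -/
theorem offset_add_ne {n i i' l u : ℕ} (hl : l < P.height n) (hu : u < P.spacer n i) :
    P.offset n i' + l ≠ P.offset n i + P.height n + u := by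
  rcases le_or_gt i' i with h | h
  · have := (P.offset_strictMono n).monotone h
    omega
  · have := (P.offset_strictMono n).monotone (show i + 1 ≤ i' from h)
    rw [offset_succ] at this
    omega

end Params

/-! ### Levels, orbits and measures of levels -/

namespace Construction

variable {P : Params} (C : Construction P)

theorem eq_of_mem_level {n i j : ℕ} {x : ℝ} (hi : i < P.height n) (hj : j < P.height n)
    (hxi : x ∈ C.level n i) (hxj : x ∈ C.level n j) : i = j := by
  by_contra hne
  exact Set.disjoint_left.mp (C.disjoint n i j hi hj hne) hxi hxj

theorem level_succ_subset {n i j : ℕ} (hi : i < P.cuts n) (hj : j < P.height n) :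
    C.level (n + 1) (P.offset n i + j) ⊆ C.level n j := by
  intro x hx
  rw [level, C.left_succ n i j hi hj] at hx
  have hw := P.width_pos (n + 1)
  have h1 : ((i : ℝ) + 1) ≤ P.cuts n := by exact_mod_cast hi
  have h2 := P.width_eq n
  have h3 : ((i : ℝ) + 1) * P.width (n + 1) ≤ P.width n := by
    rw [h2]; exact mul_le_mul_of_nonneg_right h1 hw.le
  have h4 : 0 ≤ (i : ℝ) * P.width (n + 1) := by positivity
  constructor
  · linarith [hx.1]
  · linarith [hx.2]

theorem exists_mem_level_succ {n j : ℕ} {x : ℝ} (hj : j < P.height n) (hx : x ∈ C.level n j) :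
    ∃ i < P.cuts n, x ∈ C.level (n + 1) (P.offset n i + j) := by
  have hw := P.width_pos (n + 1)
  obtain ⟨h1, h2⟩ := hx
  have h0 : 0 ≤ (x - C.left n j) / P.width (n + 1) := div_nonneg (by linarith) hw.le
  obtain ⟨i, hi⟩ : ∃ i, i = ⌊(x - C.left n j) / P.width (n + 1)⌋₊ := ⟨_, rfl⟩
  have hi1 : (i : ℝ) * P.width (n + 1) ≤ x - C.left n j := by
    rw [← le_div_iff₀ hw, hi]; exact Nat.floor_le h0
  have hi2 : x - C.left n j < ((i : ℝ) + 1) * P.width (n + 1) := by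
    rw [← div_lt_iff₀ hw, hi]; exact Nat.lt_floor_add_one _
  have hic : i < P.cuts n := by
    have := P.width_eq n
    have : (i : ℝ) * P.width (n + 1) < P.cuts n * P.width (n + 1) := by linarith
    exact_mod_cast lt_of_mul_lt_mul_right this hw.le
  refine ⟨i, hic, ?_⟩
  rw [level, C.left_succ n i j hic hj]
  constructor <;> linarith

theorem exists_mem_level_of_le {n m j : ℕ} (hnm : n ≤ m) {x : ℝ} (hj : j < P.height n)
    (hx : x ∈ C.level n j) :
    ∃ k < P.height m, x ∈ C.level m k ∧ C.level m k ⊆ C.level n j := by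
  induction m, hnm using Nat.le_induction with
  | base => exact ⟨j, hj, hx, subset_rfl⟩
  | succ m _ ih =>
    obtain ⟨k, hk, hxk, hsub⟩ := ih
    obtain ⟨i, hi, hxi⟩ := C.exists_mem_level_succ hk hxk
    have := P.offset_add_height_le m hi
    exact ⟨_, by omega, hxi, (C.level_succ_subset hi hk).trans hsub⟩

theorem level_subset_of_mem {n m j k : ℕ} (hnm : n ≤ m) {x : ℝ} (hj : j < P.height n)
    (hk : k < P.height m) (hx : x ∈ C.level n j) (hxk : x ∈ C.level m k) :
    C.level m k ⊆ C.level n j := by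
  obtain ⟨k', hk', hxk', hsub⟩ := C.exists_mem_level_of_le hnm hj hx
  rwa [C.eq_of_mem_level hk hk' hxk hxk']

theorem level_subset_space {n j : ℕ} (hj : j < P.height n) : C.level n j ⊆ C.space :=
  fun _ hx => Set.mem_iUnion.2 ⟨n, Set.mem_iUnion.2 ⟨j, Set.mem_iUnion.2 ⟨hj, hx⟩⟩⟩

theorem add_mem_level {n j k : ℕ} {x : ℝ} (hx : x ∈ C.level n j) :
    x + (C.left n k - C.left n j) ∈ C.level n k := by
  constructor <;> linarith [hx.1, hx.2]

theorem iterate_map_eq {n j d : ℕ} {x : ℝ} (h : j + d < P.height n) (hx : x ∈ C.level n j) :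
    C.map^[d] x = x + (C.left n (j + d) - C.left n j) := by
  induction d with
  | zero => simp
  | succ d ih =>
    have hmem := C.add_mem_level (k := j + d) hx
    rw [Function.iterate_succ_apply', ih (by omega), C.map_eq (by omega) hmem, ← add_assoc j d 1]
    ring

theorem iterate_map_mem {n j d : ℕ} {x : ℝ} (h : j + d < P.height n) (hx : x ∈ C.level n j) :
    C.map^[d] x ∈ C.level n (j + d) := by
  rw [C.iterate_map_eq h hx]
  exact C.add_mem_level hx

theorem measurableSet_level (n j : ℕ) : MeasurableSet (C.level n j) := measurableSet_Ico

theorem volume_level (n j : ℕ) : volume (C.level n j) = ENNReal.ofReal (P.width n) := by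
  simp [level]

theorem measurableSet_space : MeasurableSet C.space :=
  .iUnion fun n => .iUnion fun j => .iUnion fun _ => C.measurableSet_level n j

theorem measure_level {n j : ℕ} (hj : j < P.height n) :
    C.measure (C.level n j) = ENNReal.ofReal (P.width n) := by
  rw [measure, Measure.restrict_apply (C.measurableSet_level n j),
    Set.inter_eq_left.2 (C.level_subset_space hj), volume_level]

/-! ### Returns to the base of a fixed column -/

/-- The points that, whatever column they are viewed in, leave that column through a spacer of
some later column: at some stage `m` they lie in a subcolumn other than the last one. -/
def Exits (y : ℝ) : Prop :=
  ∀ n k, k < P.height n → y ∈ C.level n k → ∃ m, n ≤ m ∧ ∃ i < P.cuts m - 1,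
    y ∈ C.level (m + 1) (P.offset m i + (P.height m - P.height n + k))

theorem ae_exits : ∀ᵐ y ∂C.measure, C.Exits y := by
  refine ae_restrict_of_ae (μ := volume) ?_
  unfold Exits
  rw [ae_all_iff]
  intro n
  rw [ae_all_iff]
  intro k
  -- A point that stays in the last subcolumn at every stage from `n` on lies in all these levels,
  -- whose widths tend to `0`.
  have hnull : volume (⋂ m ≥ n, C.level m (P.height m - P.height n + k)) = 0 := by
    have hlim : Filter.Tendsto (fun m => ENNReal.ofReal (P.width m)) Filter.atTop (nhds 0) := by
      simpa using ENNReal.tendsto_ofReal P.tendsto_width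
    refine le_antisymm (ge_of_tendsto hlim ?_) zero_le
    filter_upwards [Filter.eventually_ge_atTop n] with m hm
    rw [← C.volume_level m (P.height m - P.height n + k)]
    exact measure_mono (Set.biInter_subset_of_mem hm)
  filter_upwards [compl_mem_ae_iff.2 hnull] with y hy hk hyk
  by_contra! hcon
  refine hy (Set.mem_iInter₂.2 fun m hm => ?_)
  induction m, hm using Nat.le_induction with
  | base => simpa using hyk
  | succ m hm ih =>
    have hmono := P.height_mono hm
    obtain ⟨i, hi, hyi⟩ := C.exists_mem_level_succ (by omega) ih
    have hi' : i = P.cuts m - 1 := by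
      by_contra hne
      exact hcon m hm i (by omega) hyi
    have hlast := P.offset_last m
    rw [hi'] at hyi
    convert hyi using 2
    omega

/-- If `y` is not in the last copy of column `n`, its true passage to the next copy takes `h_n +
s_n(i)` steps and also ends in the base of column `N`; a different `a` would give two visits less
than `h_N` apart. If `y` is in the last copy, it leaves through the spacers of a later stage and is
still among them at time `h_n + a`. -/
theorem return_step {N n k a : ℕ} {S : ℝ} (hNn : N ≤ n) (hS : S ≤ P.height N)
    (hgrowth : ∀ m, ∀ i < P.cuts m - 1, P.height m ≤ P.spacer m i)
    (ha : ∀ i < P.cuts n - 1, |(a : ℝ) - P.spacer n i| < S)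
    {y : ℝ} (hy : C.Exits y) (hyN : y ∈ C.level N 0) (hk : k < P.height n) (hyk : y ∈ C.level n k)
    (hret : C.map^[P.height n + a] y ∈ C.level N 0) :
    ∃ i < P.cuts n - 1, y ∈ C.level (n + 1) (P.offset n i + k) ∧ a = P.spacer n i ∧
      C.map^[P.height n + a] y ∈ C.level (n + 1) (P.offset n (i + 1) + k) := by
  have hSn : S ≤ P.height n := hS.trans (by exact_mod_cast P.height_mono hNn)
  have hcn := P.two_le_cuts n
  obtain ⟨m, hm, i, hi, hyi⟩ := hy n k hk hyk
  rcases hm.eq_or_lt with rfl | hm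
  · rw [Nat.sub_self, zero_add] at hyi
    have hle := P.offset_add_height_le n (i := i + 1) (by omega)
    have hoff := P.offset_succ n i
    have hmem : C.map^[P.height n + P.spacer n i] y ∈ C.level (n + 1) (P.offset n (i + 1) + k) := by
      have := C.iterate_map_mem (d := P.height n + P.spacer n i) (by omega) hyi
      convert this using 2
      omega
    have hmemN : C.map^[P.height n + P.spacer n i] y ∈ C.level N 0 :=
      C.level_subset_of_mem hNn (P.height_pos N) hk hyN hyk
        (C.level_succ_subset (by omega) hk hmem)
    -- Return times to the base of column `N` are at least `h_N`.
    have hno : ∀ (z : ℝ) (d : ℕ), z ∈ C.level N 0 → C.map^[d] z ∈ C.level N 0 →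
        d < P.height N → d = 0 := by
      intro z d hz hdz hd
      have := C.iterate_map_mem (d := d) (by omega) hz
      have := C.eq_of_mem_level (P.height_pos N) (by omega) hdz this
      omega
    have hai := abs_lt.1 ((ha i hi).trans_le hS)
    have heq : a = P.spacer n i := by
      rcases le_total a (P.spacer n i) with h | h
      · obtain ⟨d, hd⟩ := Nat.exists_eq_add_of_le h
        have hlt : d < P.height N := by
          have := hai.1
          rw [hd] at this
          push_cast at this
          exact_mod_cast (by linarith : (d : ℝ) < P.height N)
        have := hno _ d hret (by
          rw [← Function.iterate_add_apply]
          rwa [show d + (P.height n + a) = P.height n + P.spacer n i by omega]) hlt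
        omega
      · obtain ⟨d, hd⟩ := Nat.exists_eq_add_of_le h
        have hlt : d < P.height N := by
          have := hai.2
          rw [hd] at this
          push_cast at this
          exact_mod_cast (by linarith : (d : ℝ) < P.height N)
        have := hno _ d hmemN (by
          rw [← Function.iterate_add_apply]
          rwa [show d + (P.height n + P.spacer n i) = P.height n + a by omega]) hlt
        omega
    exact ⟨i, hi, hyi, heq, heq ▸ hmem⟩
  -- At time `h_n + a` the orbit is `a + k` above the top of a copy of column `m`, and `a + k < 2
  -- h_n + s_n(0) ≤ h_{n+1} ≤ h_m ≤ s_m(i)`: it is in a spacer, which the base of column `N` does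
  -- not meet.
  · exfalso
    have hmono := P.height_mono (show n + 1 ≤ m from hm)
    have h2 := P.two_mul_height_add_spacer_le n
    have h3 := hgrowth m i hi
    have h4 : a < P.height n + P.spacer n 0 := by
      have := (abs_lt.1 ((ha 0 (by omega)).trans_le hSn)).2
      exact_mod_cast (by linarith : (a : ℝ) < P.height n + P.spacer n 0)
    have hoff := P.offset_succ m i
    have hle := P.offset_add_height_le m (i := i + 1) (by omega)
    have hmem := C.iterate_map_mem (d := P.height n + a) (by omega) hyi
    obtain ⟨l, hl, hyl, -⟩ := C.exists_mem_level_of_le (by omega : N ≤ m) (P.height_pos N) hret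
    obtain ⟨i', hi', hyi'⟩ := C.exists_mem_level_succ hl hyl
    have hle' := P.offset_add_height_le m hi'
    have := C.eq_of_mem_level (by omega) (by omega) hyi' hmem
    exact P.offset_add_ne (i := i) (i' := i') (u := a + k) hl (by omega) (by omega)

/-! ### Density and the choice of a good orbit -/

theorem eventually_exists_level {A : Set ℝ} (hA : MeasurableSet A) (hpos : C.measure A ≠ 0)
    {c : ENNReal} (hc : c ≠ 0) :
    ∀ᶠ n in Filter.atTop, ∃ j < P.height n,
      volume (C.level n j \ A) < c * ENNReal.ofReal (P.width n) := by
  -- The complement of `A` has density `0` at almost every point of `A`. The levels around such a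
  -- point are not centred at it, hence the Vitali family with constant `1`, which admits balls
  -- merely containing the point.
  have hae := (IsUnifLocDoublingMeasure.vitaliFamily (volume : Measure ℝ) 1
    ).ae_tendsto_measure_inter_div_of_measurableSet hA.compl
  have hAX := hA.inter C.measurableSet_space
  rw [measure, Measure.restrict_apply hA] at hpos
  have : (ae (volume.restrict (A ∩ C.space))).NeBot := ae_restrict_neBot.2 hpos
  obtain ⟨x, hx, hxA, hxX⟩ := ((ae_restrict_of_ae hae).and (ae_restrict_mem hAX)).exists
  simp only [space, Set.mem_iUnion] at hxX
  obtain ⟨n₀, j₀, hj₀, hxj₀⟩ := hxX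
  have hex : ∀ n, ∃ j, n₀ ≤ n → j < P.height n ∧ x ∈ C.level n j := by
    intro n
    by_cases hn : n₀ ≤ n
    · obtain ⟨j, hj, hxj, -⟩ := C.exists_mem_level_of_le hn hj₀ hxj₀
      exact ⟨j, fun _ => ⟨hj, hxj⟩⟩
    · exact ⟨0, fun h => absurd h hn⟩
  choose j hj using hex
  have hball : ∀ n, Metric.closedBall (C.left n (j n) + P.width n / 2) (P.width n / 2)
      = Set.Icc (C.left n (j n)) (C.left n (j n) + P.width n) := by
    intro n
    rw [Real.closedBall_eq_Icc]
    congr 1 <;> ring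
  have hδ : Filter.Tendsto (fun n => P.width n / 2) Filter.atTop (nhdsWithin 0 (Set.Ioi 0)) := by
    refine tendsto_nhdsWithin_iff.2 ⟨by simpa using P.tendsto_width.div_const 2, ?_⟩
    exact Filter.Eventually.of_forall fun n => half_pos (P.width_pos n)
  have hlim := hx.comp (IsUnifLocDoublingMeasure.tendsto_closedBall_filterAt (μ := volume) (K := 1) (x := x)
    (w := fun n => C.left n (j n) + P.width n / 2) (δ := fun n => P.width n / 2) hδ (by
      filter_upwards [Filter.eventually_ge_atTop n₀] with n hn
      rw [one_mul, hball]
      exact Set.Ico_subset_Icc_self (hj n hn).2))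
  rw [Set.indicator_of_notMem (by simpa using hxA)] at hlim
  filter_upwards [hlim.eventually_lt_const (pos_iff_ne_zero.2 hc),
    Filter.eventually_ge_atTop n₀] with n hlt hn
  refine ⟨j n, (hj n hn).1, ?_⟩
  have hw : ENNReal.ofReal (P.width n) ≠ 0 := by simpa using P.width_pos n
  simp only [Function.comp_apply, hball, Real.volume_Icc, add_sub_cancel_left] at hlt
  rw [ENNReal.div_lt_iff (.inl hw) (.inl ENNReal.ofReal_ne_top)] at hlt
  refine lt_of_le_of_lt (measure_mono ?_) hlt
  rintro z ⟨hz, hzA⟩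
  exact ⟨hzA, Set.Ico_subset_Icc_self hz⟩

theorem iterate_map_offset {n i j : ℕ} {x : ℝ} (hi : i < P.cuts n) (hj : j < P.height n)
    (hx : x ∈ C.level (n + 1) j) :
    C.map^[P.offset n i] x = x + i * P.width (n + 1) := by
  have hle := P.offset_add_height_le n hi
  have h2 := P.two_le_cuts n
  have h0 := C.left_succ n 0 j (by omega) hj
  rw [P.offset_zero, zero_add] at h0
  rw [C.iterate_map_eq (by omega) hx, add_comm j, C.left_succ n i j hi hj, h0]
  push_cast
  ring

/-- Translating the missing parts of all subcolumns back to the first one gives a set of total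
measure below the width of one subinterval, so something remains there, even after removing the null
set of points whose orbit in the column violates `p`. -/
theorem exists_mem_subcolumns {A : Set ℝ} (hA : MeasurableSet A) {n j : ℕ} (hj : j < P.height n)
    (hlt : volume (C.level n j \ A) < ENNReal.ofReal (P.width (n + 1)))
    {p : ℝ → Prop} (hp : ∀ᵐ x ∂C.measure, p x) :
    ∃ x ∈ C.level (n + 1) j, (∀ i < P.cuts n, C.map^[P.offset n i] x ∈ A) ∧
      ∀ d, j + d < P.height (n + 1) → p (C.map^[d] x) := by
  have hle := fun i (hi : i < P.cuts n) => P.offset_add_height_le n hi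
  have hmiss : volume (⋃ i ∈ Finset.range (P.cuts n), (fun x => x + i * P.width (n + 1)) ⁻¹'
      (C.level (n + 1) (P.offset n i + j) \ A)) ≤ volume (C.level n j \ A) := by
    refine (measure_biUnion_finset_le _ _).trans ?_
    simp only [measure_preimage_add_right]
    rw [← measure_biUnion_finset]
    · refine measure_mono (Set.iUnion₂_subset fun i hi => ?_)
      exact Set.sdiff_subset_sdiff_left (C.level_succ_subset (Finset.mem_range.1 hi) hj)
    · intro i hi i' hi' hne
      have hi := hle i (by simpa using hi)
      have hi' := hle i' (by simpa using hi')
      refine (C.disjoint (n + 1) _ _ (by omega) (by omega) ?_).mono Set.sdiff_subset Set.sdiff_subset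
      intro h
      exact hne ((P.offset_strictMono n).injective (by omega))
    · exact fun i _ => (C.measurableSet_level _ _).diff hA
  have hnull : volume {x | ¬ (x ∈ C.space → p x)} = 0 :=
    (ae_restrict_iff' C.measurableSet_space).1 hp
  have hbad : volume (⋃ d, (fun x => x + (C.left (n + 1) (j + d) - C.left (n + 1) j)) ⁻¹'
      {x | ¬ (x ∈ C.space → p x)}) = 0 := by
    refine measure_iUnion_null fun d => ?_
    rw [measure_preimage_add_right, hnull]
  obtain ⟨x, hx, hxbad⟩ : (C.level (n + 1) j \ ((⋃ i ∈ Finset.range (P.cuts n),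
      (fun x => x + i * P.width (n + 1)) ⁻¹' (C.level (n + 1) (P.offset n i + j) \ A)) ∪
      ⋃ d, (fun x => x + (C.left (n + 1) (j + d) - C.left (n + 1) j)) ⁻¹'
      {x | ¬ (x ∈ C.space → p x)})).Nonempty := by
    refine Set.sdiff_nonempty.2 fun hsub => ?_
    have := (measure_mono (μ := volume) hsub).trans (measure_union_le _ _)
    rw [hbad, add_zero, volume_level] at this
    exact absurd (hmiss.trans_lt hlt) this.not_gt
  simp only [Set.mem_union, Set.mem_iUnion, not_or, not_exists] at hxbad
  refine ⟨x, hx, fun i hi => ?_, fun d hd => ?_⟩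
  · have hle := hle i hi
    by_contra hcon
    refine hxbad.1 i (Finset.mem_range.2 hi) ⟨?_, ?_⟩
    · simp only
      rw [← C.iterate_map_offset hi hj hx, add_comm _ j]
      exact C.iterate_map_mem (by omega) hx
    · rwa [C.iterate_map_offset hi hj hx] at hcon
  · have hmem := C.iterate_map_mem hd hx
    have := hxbad.2 d
    rw [Set.mem_preimage, ← C.iterate_map_eq hd hx, Set.mem_ofPred_eq, not_not] at this
    exact this (C.level_subset_space hd hmem)

end Construction

/-! ### Comparison of the two systems -/

open Construction in
/-- If almost every orbit of `X` is intertwined with an orbit of `Y`, then the spacer parameters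
of the two systems eventually agree at the stages with a bounded number of cuts. -/
theorem eventually_spacer_eq {P P' : Params} (X : Construction P) (Y : Construction P')
    (hcuts : ∀ n, P.cuts n = P'.cuts n) (hheight : ∀ n, P.height n = P'.height n) {S : ℝ}
    (hclose : ∀ n, ∀ i < P.cuts n - 1, ∀ j < P.cuts n - 1,
      |(P.spacer n i : ℝ) - P'.spacer n j| < S)
    (hgrowth : ∀ n, ∀ i < P'.cuts n - 1, P'.height n ≤ P'.spacer n i)
    {φ : ℝ → ℝ} (hφ : MeasurePreserving φ X.measure Y.measure)
    (hint : ∀ᵐ x ∂X.measure, φ (X.map x) = Y.map (φ x)) (Q : ℕ) :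
    ∀ᶠ n in Filter.atTop, P.cuts n ≤ Q → ∀ i < P.cuts n - 1, P.spacer n i = P'.spacer n i := by
  obtain ⟨N, hN⟩ := exists_nat_ge S
  have hNS : S ≤ P'.height N := hN.trans (by exact_mod_cast (P'.lt_height N).le)
  have hA : MeasurableSet (φ ⁻¹' Y.level N 0) := hφ.measurable (Y.measurableSet_level N 0)
  have hpos : X.measure (φ ⁻¹' Y.level N 0) ≠ 0 := by
    rw [hφ.measure_preimage (Y.measurableSet_level N 0).nullMeasurableSet,
      Y.measure_level (P'.height_pos N)]
    simpa using P'.width_pos N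
  filter_upwards [X.eventually_exists_level hA hpos
    (c := (Q : ENNReal)⁻¹) (by simp), Filter.eventually_ge_atTop N] with n hn hNn hQ
  obtain ⟨j, hj, hlt⟩ := hn
  -- The factor `1/Q` of the old width is at most one new width, because there are at most `Q` cuts.
  have hlt' : volume (X.level n j \ φ ⁻¹' Y.level N 0) < ENNReal.ofReal (P.width (n + 1)) := by
    refine hlt.trans_le ?_
    have h2 := P.two_le_cuts n
    rw [P.width_eq, ENNReal.ofReal_mul (by positivity), ENNReal.ofReal_natCast, ← mul_assoc]
    refine mul_le_of_le_one_left zero_le ?_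
    rw [mul_comm, ← div_eq_mul_inv]
    exact ENNReal.div_le_of_le_mul (by rw [one_mul]; exact_mod_cast hQ)
  obtain ⟨x, hx, hxA, hxp⟩ := X.exists_mem_subcolumns hA hj hlt'
    (hint.and (hφ.quasiMeasurePreserving.ae Y.ae_exits))
  have hφiter : ∀ d, j + d < P.height (n + 1) → φ (X.map^[d] x) = Y.map^[d] (φ x) := by
    intro d
    induction d with
    | zero => simp
    | succ d ih =>
      intro hd
      rw [Function.iterate_succ_apply', Function.iterate_succ_apply', (hxp d (by omega)).1,
        ih (by omega)]
  have hle := fun i (hi : i < P.cuts n) => P.offset_add_height_le n hi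
  have hyN : ∀ i < P.cuts n, Y.map^[P.offset n i] (φ x) ∈ Y.level N 0 := by
    intro i hi
    have := hle i hi
    rw [← hφiter _ (by omega)]
    exact hxA i hi
  have hyE : ∀ i < P.cuts n, Y.Exits (Y.map^[P.offset n i] (φ x)) := by
    intro i hi
    have := hle i hi
    rw [← hφiter _ (by omega)]
    exact (hxp _ (by omega)).2
  have h2 := P.two_le_cuts n
  have hy0 := hyN 0 (by omega)
  rw [P.offset_zero, Function.iterate_zero_apply] at hy0
  obtain ⟨k, hk, hyk, -⟩ := Y.exists_mem_level_of_le hNn (P'.height_pos N) hy0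
  obtain ⟨a, ha, hya⟩ := Y.exists_mem_level_succ hk hyk
  -- The returns of `x` to its level are matched with consecutive returns of `φ x`.
  have hstep : ∀ i < P.cuts n - 1,
      Y.map^[P.offset n i] (φ x) ∈ Y.level (n + 1) (P'.offset n (a + i) + k) →
      a + i < P'.cuts n →
      a + i < P'.cuts n - 1 ∧ P.spacer n i = P'.spacer n (a + i) ∧
      Y.map^[P.offset n (i + 1)] (φ x) ∈ Y.level (n + 1) (P'.offset n (a + (i + 1)) + k) := by
    intro i hi hmem hai
    have hret : Y.map^[P'.height n + P.spacer n i] (Y.map^[P.offset n i] (φ x))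
        = Y.map^[P.offset n (i + 1)] (φ x) := by
      rw [← Function.iterate_add_apply, P.offset_succ, hheight]
      rw [show P'.height n + P.spacer n i + P.offset n i
        = P.offset n i + P'.height n + P.spacer n i by omega]
    obtain ⟨b, hb, hmem', heq, hnext⟩ := Y.return_step hNn hNS hgrowth
      (fun l hl => hclose n i hi l (by rwa [hcuts])) (hyE i (by omega)) (hyN i (by omega)) hk
      (Y.level_succ_subset hai hk hmem) (hret ▸ hyN (i + 1) (by omega))
    have h1 := P'.offset_add_height_le n hai
    have h3 := P'.offset_add_height_le n (show b < P'.cuts n by omega)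
    have hab := Y.eq_of_mem_level (by omega) (by omega) hmem hmem'
    obtain rfl : a + i = b := (P'.offset_strictMono n).injective (by omega)
    exact ⟨hb, heq, hret ▸ hnext⟩
  have hall : ∀ i < P.cuts n,
      Y.map^[P.offset n i] (φ x) ∈ Y.level (n + 1) (P'.offset n (a + i) + k) ∧
        a + i < P'.cuts n := by
    intro i
    induction i with
    | zero => exact fun _ => by simpa [P.offset_zero] using ⟨hya, ha⟩
    | succ i ih =>
      intro hi
      obtain ⟨hmem, hai⟩ := ih (by omega)
      obtain ⟨hlt, -, hnext⟩ := hstep i (by omega) hmem hai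
      exact ⟨hnext, by omega⟩
  -- The orbit occupies `r_n` consecutive copies starting from copy `a`, and there are only `r_n`
  -- copies.
  obtain rfl : a = 0 := by
    have := (hall (P.cuts n - 1) (by omega)).2
    have := hcuts n
    omega
  intro i hi
  obtain ⟨hmem, hai⟩ := hall i (by omega)
  simpa using (hstep i hi hmem hai).2.1

end RankOne

theorem proposition6p3 (P P' : RankOne.Params)
    (X : RankOne.Construction P) (Y : RankOne.Construction P')
    -- the parameters are commensurable
    (hcuts : ∀ n, P.cuts n = P'.cuts n)
    (hsum : ∀ n, ∑ i, P.spacers n i = ∑ i, P'.spacers n i)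
    -- the spacer numbers are uniformly close
    (hclose : ∃ 𝔖 : ℝ, 0 < 𝔖 ∧ ∀ (n : ℕ) (i : Fin (P.cuts n - 1)) (j : Fin (P'.cuts n - 1)),
      |(P.spacers n i : ℝ) - (P'.spacers n j : ℝ)| < 𝔖)
    -- the spacer numbers are at least the lengths of the words
    (hgrowth : ∀ (n : ℕ) (i : Fin (P.cuts n - 1)), (P.word n).length ≤ P.spacers n i)
    (hgrowth' : ∀ (n : ℕ) (i : Fin (P'.cuts n - 1)), (P'.word n).length ≤ P'.spacers n i)
    -- a subsequence of words, with its cutting and spacer parameters `q`, `t` and `q`, `t'`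
    (hsub : ∃ (k : ℕ → ℕ) (q : ℕ → ℕ) (t t' : ℕ → List ℕ),
      StrictMono k ∧
      (∀ l, (t l).length + 1 = q l ∧ (t' l).length + 1 = q l) ∧
      (∀ l, P.word (k (l + 1)) = RankOne.build (P.word (k l)) (t l)) ∧
      (∀ l, P'.word (k (l + 1)) = RankOne.build (P'.word (k l)) (t' l)) ∧
      ∃ (𝔔 : ℝ) (M : Set ℕ), 0 < 𝔔 ∧ M.Infinite ∧ ∀ l ∈ M, (q l : ℝ) < 𝔔 ∧
        RankOne.Incompatible ((t l).map (Nat.cast : ℕ → ℤ)) ((t' l).map (Nat.cast : ℕ → ℤ))) :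
    ¬ RankOne.Isomorphic X.measure X.map Y.measure Y.map := by
  rintro ⟨φ, -, hφ, -, -, -, hint⟩
  obtain ⟨S, -, hclose⟩ := hclose
  obtain ⟨k, q, t, t', hk, hq, ht, ht', 𝔔, M, -, hM, hinc⟩ := hsub
  obtain ⟨Q, hQ⟩ := exists_nat_ge 𝔔
  have hheight : ∀ n, P.height n = P'.height n := by
    intro n
    induction n with
    | zero => rfl
    | succ n ih => rw [RankOne.Params.height, RankOne.Params.height, ih, hsum, hcuts]
  have hev := RankOne.eventually_spacer_eq X Y hcuts hheight (S := S)
    (fun n i hi j hj => by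
      rw [P.spacer_eq hi, P'.spacer_eq (hcuts n ▸ hj)]
      exact hclose n _ _)
    (fun n i hi => by
      rw [P'.spacer_eq hi, ← P'.length_word]
      exact hgrowth' n _) hφ hint Q
  obtain ⟨n₀, hn₀⟩ := Filter.eventually_atTop.1 hev
  obtain ⟨l, hlM, hl⟩ := hM.exists_gt n₀
  obtain ⟨hql, hincl⟩ := hinc l hlM
  -- If they were equal, `t` would be a prefix of `t' c t'` for any `c`; the value `0` is arbitrary.
  have hne : t l ≠ t' l := fun h =>
    hincl ⟨0, [], 0 :: (t' l).map (Nat.cast : ℕ → ℤ), by rw [h]; simp⟩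
  obtain ⟨n, hn, hcn, hsp⟩ :=
    RankOne.Params.exists_spacers_ne (hk (Nat.lt_succ_self l)).le (ht l) (ht' l) hne
  have hqQ : q l ≤ Q := by exact_mod_cast (hql.le.trans hQ)
  -- Gives `n₀ < l ≤ k l ≤ n`, so stage `n` is late enough.
  have hkl := hk.le_apply (x := l)
  have heq := hn₀ n (by omega) (hcn.trans ((hq l).1.trans_le hqQ))
  refine hsp (List.ext_getElem (by simp [hcuts]) fun i h1 h2 => ?_)
  rw [List.length_ofFn] at h1 h2
  simpa [P.spacer_eq h1, P'.spacer_eq h2] using heq i h1
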